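/- Let $\mathbb{D}$ be the open unit ball of the quaternions $\mathbb{H}$ and let $\mathbb{S}=\{i\in\mathbb{H}: \operatorname{Re} i=0,\ |i|=1\}$. A real differentiable function $f:\mathbb{D}\to\mathbb{H}$ is called left slice hyperholomorphic if $f(a+ib)=\alpha(a,b)+i\beta(a,b)$ for all $i\in\mathbb{S}$ and all real $a,b$ with $a+ib\in\mathbb{D}$, where $\alpha,\beta$ are $\mathbb{H}$-valued functions with $\alpha(a,-b)=\alpha(a,b)$, $\beta(a,-b)=-\beta(a,b)$, $\partial_a\alpha=\partial_b\beta$ and $\partial_a\beta=-\partial_b\alpha$. Let $\mathcal{H}$ be a quaternionic right Hilbert space (with scalar product $\langle\cdot,\cdot\rangle$ right linear in the second argument) whose elements are left slice hyperholomorphic functions on $\mathbb{D}$, with pointwise operations, such that each point evaluation $f\mapsto f(w)$, $w\in\mathbb{D}$, is bounded on $\mathcal{H}$, and such that for each $q\in\mathbb{D}$ there is $f\in\mathcal{H}$ with $f(q)\neq 0$. Let $K_w\in\mathcal{H}$ be the reproducing kernel function, $f(w)=\langle K_w,f\rangle$ for all $f\in\mathcal{H}$, put $K(q,w)=K_w(q)$,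 and let $k_q=K_q/\sqrt{K(q,q)}$. Fix $i\in\mathbb{S}$, put $\mathbb{C}_i=\{a+ib: a,b\in\mathbb{R}\}$ and $\mathbb{D}_i=\mathbb{D}\cap\mathbb{C}_i$, and let $J$ be a bounded right linear operator on $\mathcal{H}$ that is unitary and anti-selfadjoint and satisfies $$\{x\in\mathcal{H}: Jx=xi\}=\overline{\operatorname{span}_{\mathbb{C}_i}\{K_q: q\in\mathbb{D}_i\}}$$ (right linear span over $\mathbb{C}_i$). Let $\mathcal{B}_J(\mathcal{H})$ be the set of all bounded right linear operators $T$ on $\mathcal{H}$ with $TJ=JT$, and for $T\in\mathcal{B}_J(\mathcal{H})$ let $\widetilde T:\mathbb{D}_i\to\mathbb{H}$, $\widetilde T(q)=\langle k_q,Tk_q\rangle$, be its Berezin transform. Then the Berezin transform $T\mapsto\widetilde T$ is one-to-one on $\mathcal{B}_J(\mathcal{H})$: if $T,S\in\mathcal{B}_J(\mathcal{H})$ and $\widetilde T(q)=\widetilde S(q)$ for all $q\in\mathbb{D}_i$, then $T=S$. -/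

import Mathlib

open Quaternion MulOpposite

namespace QuaternionicBerezin

/-- The sphere `𝕊` of imaginary units of the quaternions. -/
def imagUnits : Set ℍ := {i | i.re = 0 ∧ ‖i‖ = 1}

/-- The complex plane `ℂ_i = {a + i b : a, b real}` in the quaternions. -/
def slicePlane (i : ℍ) : Set ℍ := {x | ∃ a b : ℝ, x = (a : ℍ) + i * (b : ℍ)}

/-- The open unit ball `𝔻` of the quaternions. -/
def unitBall : Set ℍ := Metric.ball 0 1

/-- Left slice hyperholomorphic functions on an axially symmetric open set `U` of quaternions:
real differentiable functions of the form `f (a + i b) = α (a, b) + i β (a, b)`, for all imaginary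
units `i`, where `α` is even and `β` is odd in `b`, and `α, β` satisfy the Cauchy-Riemann system
on the planar set `{(a, b) : a + i b ∈ U}` (which does not depend on `i`). The functions
`F, α, β` are only relevant on `U`, respectively on this planar set. -/
def IsLeftSliceHyperholomorphic {U : Set ℍ} (f : U → ℍ) : Prop :=
  (∃ F : ℍ → ℍ, (∀ x : U, F x = f x) ∧ DifferentiableOn ℝ F U) ∧
  ∃ α β : ℝ × ℝ → ℍ,
    (∀ i ∈ imagUnits, ∀ a b : ℝ, ∀ h : (a : ℍ) + i * (b : ℍ) ∈ U,
      f ⟨(a : ℍ) + i * (b : ℍ), h⟩ = α (a, b) + i * β (a, b)) ∧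
    (∀ i ∈ imagUnits, ∀ a b : ℝ, (a : ℍ) + i * (b : ℍ) ∈ U →
      α (a, -b) = α (a, b) ∧ β (a, -b) = -β (a, b) ∧
      DifferentiableAt ℝ α (a, b) ∧ DifferentiableAt ℝ β (a, b) ∧
      deriv (fun s => α (s, b)) a = deriv (fun t => β (a, t)) b ∧
      deriv (fun s => β (s, b)) a = -deriv (fun t => α (a, t)) b)

/-- Quaternionic (right) Hilbert spaces. The right scalar multiplication `x a` is the action
`op a • x`; the scalar product is right linear in its second argument and the norm of the space
is `√⟨x, x⟩`. -/
class QuaternionicHilbertSpace (H : Type*) [NormedAddCommGroup H] [Module ℍᵐᵒᵖ H] where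
  /-- the quaternion-valued scalar product -/
  ip : H → H → ℍ
  ip_self_nonneg : ∀ x, ∃ r : ℝ, 0 ≤ r ∧ ip x x = (r : ℍ)
  ip_self_eq_zero : ∀ x, ip x x = 0 ↔ x = 0
  ip_smul_add : ∀ (x y z : H) (a : ℍ), ip x (op a • y + z) = ip x y * a + ip x z
  ip_star : ∀ x y, ip x y = star (ip y x)
  norm_eq : ∀ x, ‖x‖ = √(ip x x).re
  complete : CompleteSpace H

/-- Quaternionic reproducing kernel Hilbert spaces of left slice hyperholomorphic functions on the
unit ball: the elements of `H` are functions on the unit ball, with pointwise operations, and all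
point evaluations are bounded. -/
class SliceRKHS (H : Type*) [NormedAddCommGroup H] [Module ℍᵐᵒᵖ H]
    [QuaternionicHilbertSpace H] where
  /-- an element of `H` as a function on the unit ball -/
  eval : H →ₗ[ℍᵐᵒᵖ] (unitBall → ℍ)
  eval_injective : Function.Injective eval
  slice : ∀ f : H, IsLeftSliceHyperholomorphic (eval f)
  bounded : ∀ w : unitBall, ∃ C : ℝ, ∀ f : H, ‖eval f w‖ ≤ C * ‖f‖

section

variable {H : Type*} [NormedAddCommGroup H] [Module ℍᵐᵒᵖ H] [QuaternionicHilbertSpace H]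

open QuaternionicHilbertSpace SliceRKHS

theorem ip_add (x y z : H) : ip x (y + z) = ip x y + ip x z := by
  have h := ip_smul_add x y z 1
  simpa using h

theorem ip_zero (x : H) : ip x (0 : H) = 0 := by
  have h := ip_add x 0 0
  simpa using h

theorem ip_smul (x y : H) (a : ℍ) : ip x (op a • y) = ip x y * a := by
  have h := ip_smul_add x y 0 a
  simpa [ip_zero] using h

theorem ip_add_left (x y z : H) : ip (x + y) z = ip x z + ip y z := by
  rw [ip_star, ip_add, star_add, ← ip_star, ← ip_star]

theorem ip_smul_left (x y : H) (a : ℍ) : ip (op a • x) y = star a * ip x y := by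
  rw [ip_star, ip_smul, star_mul, ← ip_star]

theorem norm_sq_eq (x : H) : ‖x‖ ^ 2 = (ip x x).re := by
  obtain ⟨r, hr, h⟩ := ip_self_nonneg x
  rw [norm_eq, Real.sq_sqrt]
  rw [h]
  simpa using hr

theorem norm_op_smul (x : H) (a : ℍ) : ‖op a • x‖ = ‖x‖ * ‖a‖ := by
  obtain ⟨r, -, h⟩ := ip_self_nonneg x
  have h1 : ‖op a • x‖ ^ 2 = (‖x‖ * ‖a‖) ^ 2 := by
    rw [norm_sq_eq, mul_pow, norm_sq_eq, ip_smul, ip_smul_left, h, ← Quaternion.coe_commutes,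
      mul_assoc, Quaternion.star_mul_self, Quaternion.normSq_eq_norm_mul_self]
    simp [sq]
  exact (pow_left_inj₀ (norm_nonneg _) (by positivity) two_ne_zero).mp h1

/-- The Riesz representation theorem for point evaluations. -/
theorem exists_kernel [SliceRKHS H] (w : unitBall) :
    ∃ K : H, ∀ f : H, eval f w = ip K f := by
  let _ : Module ℝ H := Module.compHom H (algebraMap ℝ ℍᵐᵒᵖ)
  have hsm : ∀ (r : ℝ) (x : H), r • x = op (r : ℍ) • x := fun r x => rfl
  let _ : InnerProductSpace ℝ H :=
    { norm_smul_le := fun r x => by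
        rw [hsm, norm_op_smul, Quaternion.norm_coe, mul_comm]
      inner := fun x y => (ip x y).re
      norm_sq_eq_re_inner := fun x => by
        rw [norm_sq_eq]; rfl
      conj_inner_symm := fun x y => by
        change (ip y x).re = (ip x y).re
        rw [ip_star x y]; simp
      add_left := fun x y z => by
        change (ip (x + y) z).re = (ip x z).re + (ip y z).re
        rw [ip_add_left]; simp
      smul_left := fun x y r => by
        change (ip (r • x) y).re = r * (ip x y).re
        rw [hsm, ip_smul_left]; simp }
  have : CompleteSpace H := complete
  obtain ⟨C, hC⟩ := bounded (H := H) w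
  let φ : H →ₗ[ℝ] ℝ :=
    { toFun := fun f => (eval f w).re
      map_add' := fun f g => by simp
      map_smul' := fun r f => by
        rw [hsm, map_smul]; simp [mul_comm] }
  let Φ : StrongDual ℝ H := φ.mkContinuous C fun f =>
    (abs_le_of_sq_le_sq (by
      rw [sq ‖_‖, ← Quaternion.normSq_eq_norm_mul_self, Quaternion.normSq_def']
      nlinarith [sq_nonneg (eval f w).imI, sq_nonneg (eval f w).imJ, sq_nonneg (eval f w).imK])
      (norm_nonneg _) : |(eval f w).re| ≤ ‖eval f w‖).trans (hC f)
  refine ⟨(InnerProductSpace.toDual ℝ H).symm Φ, fun f => ?_⟩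
  set K : H := (InnerProductSpace.toDual ℝ H).symm Φ
  have key : ∀ g : H, (eval g w).re = (ip K g).re := fun g =>
    (InnerProductSpace.toDual_symm_apply (x := g) (y := Φ)).symm
  have key2 : ∀ a : ℍ, (eval f w * a).re = (ip K f * a).re := fun a => by
    rw [← ip_smul, ← key, map_smul]; rfl
  simp only [Quaternion.re_mul] at key2
  have h1 := key2 ⟨1, 0, 0, 0⟩
  have hi := key2 ⟨0, 1, 0, 0⟩
  have hj := key2 ⟨0, 0, 1, 0⟩
  have hk := key2 ⟨0, 0, 0, 1⟩
  ext <;> linarith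

/-- The reproducing kernel function `K_w`, the element of `H` with `f(w) = ⟨K_w, f⟩` for all
`f`. -/
noncomputable def kernelFun (H : Type*) [NormedAddCommGroup H] [Module ℍᵐᵒᵖ H]
    [QuaternionicHilbertSpace H] [SliceRKHS H] (w : unitBall) : H :=
  (exists_kernel (H := H) w).choose

/-- The reproducing kernel `K(q, w) = K_w(q)`. -/
noncomputable def kernel (H : Type*) [NormedAddCommGroup H] [Module ℍᵐᵒᵖ H]
    [QuaternionicHilbertSpace H] [SliceRKHS H] (q w : unitBall) : ℍ :=
  eval (kernelFun H w) q

/-- The normalized reproducing kernel `k_q = K_q / √K(q, q)`. -/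
noncomputable def normalizedKernel (H : Type*) [NormedAddCommGroup H] [Module ℍᵐᵒᵖ H]
    [QuaternionicHilbertSpace H] [SliceRKHS H] (q : unitBall) : H :=
  op (((√(kernel H q q).re)⁻¹ : ℝ) : ℍ) • kernelFun H q

/-- `S` is the adjoint of the bounded right linear operator `T`. -/
def IsAdjoint (T S : H →L[ℍᵐᵒᵖ] H) : Prop := ∀ x y : H, ip (S x) y = ip x (T y)

/-- `T* = -T`. -/
def IsAntiSelfAdjoint (T : H →L[ℍᵐᵒᵖ] H) : Prop := IsAdjoint T (-T)

/-- `T* = T⁻¹`. -/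
def IsUnitary (T : H →L[ℍᵐᵒᵖ] H) : Prop :=
  ∃ S : H →L[ℍᵐᵒᵖ] H, IsAdjoint T S ∧ T.comp S = ContinuousLinearMap.id ℍᵐᵒᵖ H ∧
    S.comp T = ContinuousLinearMap.id ℍᵐᵒᵖ H

/-- The complex subspace `H₊ = {x : J x = x i}`. -/
def plusSpace (J : H →L[ℍᵐᵒᵖ] H) (i : ℍ) : Set H := {x | J x = op i • x}

/-- The set `𝓑_J(H)` of bounded right linear operators commuting with `J`. -/
def commutingOperators (J : H →L[ℍᵐᵒᵖ] H) : Set (H →L[ℍᵐᵒᵖ] H) := {T | T.comp J = J.comp T}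

/-- The right linear span over `ℂ_i` of a set of vectors. -/
def sliceSpan (i : ℍ) (s : Set H) : Set H :=
  AddSubgroup.closure {y | ∃ x ∈ s, ∃ a ∈ slicePlane i, y = op a • x}

/-- The unit disc `𝔻_i = 𝔻 ∩ ℂ_i`, as a subset of the unit ball. -/
def sliceDisc (i : ℍ) : Set unitBall := {q | (q : ℍ) ∈ slicePlane i}

/-- The Berezin transform of `T`: the function `q ↦ ⟨k_q, T k_q⟩` on `𝔻_i`. -/
noncomputable def berezin [SliceRKHS H] (i : ℍ) (T : H →L[ℍᵐᵒᵖ] H) : sliceDisc i → ℍ :=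
  fun q => ip (normalizedKernel H q) (T (normalizedKernel H q))

end

end QuaternionicBerezin

open QuaternionicBerezin

/-!
Right multiplication by `ℂ_i` turns `H` into a complex Hilbert space. Let `A = T - S`, where `T`
and `S` have the same Berezin transform, and for `z`, `w` in the complex unit disc let `K_z` be
the kernel function at the point of `𝔻_i` corresponding to `z`. The symbol `⟨K_z, A K_{w̄}⟩`,
with values in the `ℂ_i`-part of the scalar product, is holomorphic in `z` and `w` separately
and locally bounded, hence jointly holomorphic by Osgood's lemma. Equality of the Berezin
transforms makes it vanish on the antidiagonal `w = z̄`, which is totally real, so it vanishes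
identically and `A K_w` is orthogonal to all `K_z`. As `A` preserves the closed `ℂ_i`-span of
these vectors, `A K_w` is orthogonal to itself, that is, `A K_w = 0`. Finally the `K_w` have
dense right quaternionic span, because a slice hyperholomorphic function that vanishes on `𝔻_i`
vanishes everywhere.
-/

namespace QuaternionicBerezin

section SeveralComplexVariables

open Filter Metric Set
open scoped Topology ComplexConjugate

variable {E : Type*} [NormedAddCommGroup E] [NormedSpace ℂ E]

theorem tendstoUniformlyOn_of_differentiableOn_ball {f : ℂ → ℂ → E} {U : Set ℂ} {w₀ : ℂ} {r M : ℝ}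
    (hr : 0 < r) (hd : ∀ z ∈ U, DifferentiableOn ℂ (f z) (ball w₀ r))
    (hM : ∀ z ∈ U, ∀ w ∈ ball w₀ r, ‖f z w‖ ≤ M) :
    TendstoUniformlyOn (fun w z => f z w) (fun z => f z w₀) (𝓝 w₀) U := by
  have schwarz : ∀ z ∈ U, ∀ w ∈ ball w₀ r, dist (f z w) (f z w₀) ≤ (M + M) / r * dist w w₀ := by
    intro z hz w hw
    refine Complex.dist_le_div_mul_dist_of_mapsTo_ball (hd z hz) (fun v hv => ?_) hw
    exact mem_closedBall.2 <| (dist_le_norm_add_norm _ _).trans <|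
      add_le_add (hM z hz v hv) (hM z hz w₀ (mem_ball_self hr))
  have bound_tendsto : Tendsto (fun w => (M + M) / r * dist w w₀) (𝓝 w₀) (𝓝 0) := by
    have : Continuous fun w => (M + M) / r * dist w w₀ := by fun_prop
    simpa only [dist_self, mul_zero] using this.tendsto w₀
  refine Metric.tendstoUniformlyOn_iff.2 fun ε hε => ?_
  filter_upwards [bound_tendsto.eventually_lt_const hε, ball_mem_nhds w₀ hr] with w hlt hw z hz
  exact (dist_comm _ _).trans_lt ((schwarz z hz w hw).trans_lt hlt)

theorem continuousAt_deriv_left_of_separately_differentiable [CompleteSpace E]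
    {f : ℂ → ℂ → E} {p : ℂ × ℂ} {M : ℝ}
    (h₁ : ∀ᶠ v in 𝓝 p, DifferentiableAt ℂ (f · v.2) v.1)
    (h₂ : ∀ᶠ v in 𝓝 p, DifferentiableAt ℂ (f v.1) v.2)
    (hM : ∀ᶠ v in 𝓝 p, ‖f v.1 v.2‖ ≤ M) :
    ContinuousAt (fun v => deriv (f · v.2) v.1) p := by
  obtain ⟨U, V, hU, hpU, hV, hpV, hUV⟩ := mem_nhds_prod_iff'.1 (h₁.and (h₂.and hM))
  obtain ⟨r, hr, hrV⟩ := Metric.isOpen_iff.1 hV p.2 hpV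
  have slice_differentiableOn : ∀ w ∈ V, DifferentiableOn ℂ (f · w) U := fun w hw z hz =>
    (hUV (mk_mem_prod hz hw)).1.differentiableWithinAt
  have uniform : TendstoUniformlyOn (fun v : ℂ × ℂ => (f · v.2)) (f · p.2) (𝓝 p) U := by
    have := tendstoUniformlyOn_of_differentiableOn_ball (f := f) (U := U) hr
      (fun z hz w hw => (hUV (mk_mem_prod hz (hrV hw))).2.1.differentiableWithinAt)
      (fun z hz w hw => (hUV (mk_mem_prod hz (hrV hw))).2.2)
    exact fun u hu => continuousAt_snd.eventually (this u hu)
  have deriv_uniform := uniform.tendstoLocallyUniformlyOn.deriv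
    ((continuousAt_snd.eventually (hV.mem_nhds hpV)).mono fun v hv =>
      slice_differentiableOn v.2 hv) hU
  exact deriv_uniform.tendsto_comp
    (((slice_differentiableOn p.2 hpV).deriv hU).continuousOn p.1 hpU) hpU
    (tendsto_nhdsWithin_of_tendsto_nhds_of_eventually_within _ continuousAt_fst
      (continuousAt_fst.eventually (hU.mem_nhds hpU)))

theorem differentiableAt_uncurry_of_separately_differentiable [CompleteSpace E]
    {f : ℂ → ℂ → E} {p : ℂ × ℂ} {M : ℝ}
    (h₁ : ∀ᶠ v in 𝓝 p, DifferentiableAt ℂ (f · v.2) v.1)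
    (h₂ : ∀ᶠ v in 𝓝 p, DifferentiableAt ℂ (f v.1) v.2)
    (hM : ∀ᶠ v in 𝓝 p, ‖f v.1 v.2‖ ≤ M) :
    DifferentiableAt ℂ ↿f p := by
  have deriv_left : ContinuousAt (fun v : ℂ × ℂ => deriv (f · v.2) v.1) p :=
    continuousAt_deriv_left_of_separately_differentiable h₁ h₂ hM
  have deriv_right : ContinuousAt (fun v : ℂ × ℂ => deriv (f v.1) v.2) p := by
    have hswap : Tendsto Prod.swap (𝓝 p.swap) (𝓝 p) := continuous_swap.tendsto p.swap
    exact (continuousAt_deriv_left_of_separately_differentiable (f := fun w z => f z w)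
      (p := p.swap) (hswap.eventually h₂) (hswap.eventually h₁) (hswap.eventually hM)).comp
        continuous_swap.continuousAt
  have toSpanSingleton_continuous :
      Continuous (ContinuousLinearMap.toSpanSingleton ℂ : E → ℂ →L[ℂ] E) :=
    (ContinuousLinearMap.toSpanSingletonCLE (𝕜 := ℂ) (E := E)).continuous
  exact (hasStrictFDerivAt_uncurry_coprod (𝕜 := ℂ)
    (f₁ := fun z w => ContinuousLinearMap.toSpanSingleton ℂ (deriv (f · w) z))
    (f₂ := fun z w => ContinuousLinearMap.toSpanSingleton ℂ (deriv (f z) w))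
    (h₁.mono fun v hv => hv.hasDerivAt.hasFDerivAt)
    (h₂.mono fun v hv => hv.hasDerivAt.hasFDerivAt)
    (toSpanSingleton_continuous.continuousAt.comp deriv_left)
    (toSpanSingleton_continuous.continuousAt.comp deriv_right)).differentiableAt

theorem eqOn_zero_of_eventually_ofReal_eq_zero [CompleteSpace E] {h : ℂ → E} {U : Set ℂ} {x : ℝ}
    (hU : IsOpen U) (hUc : IsPreconnected U) (hx : (x : ℂ) ∈ U) (hd : DifferentiableOn ℂ h U)
    (h0 : ∀ᶠ t : ℝ in 𝓝 x, h t = 0) : EqOn h 0 U := by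
  have ofReal_tendsto : Tendsto ((↑) : ℝ → ℂ) (𝓝[≠] x) (𝓝[≠] (x : ℂ)) :=
    Complex.continuous_ofReal.continuousAt.continuousWithinAt.tendsto_nhdsWithin
      fun t ht => Complex.ofReal_injective.ne ht
  exact (hd.analyticOnNhd hU).eqOn_zero_of_preconnected_of_frequently_eq_zero hUc hx
    (ofReal_tendsto.frequently (h0.filter_mono nhdsWithin_le_nhds).frequently)

theorem eqOn_zero_prod_of_ofReal_eq_zero [CompleteSpace E] {h : ℂ × ℂ → E} {U V : Set ℂ} {x y : ℝ}
    (hU : IsOpen U) (hUc : IsPreconnected U) (hx : (x : ℂ) ∈ U)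
    (hV : IsOpen V) (hVc : IsPreconnected V) (hy : (y : ℂ) ∈ V)
    (hd : DifferentiableOn ℂ h (U ×ˢ V))
    (h0 : ∀ s t : ℝ, (s : ℂ) ∈ U → (t : ℂ) ∈ V → h (s, t) = 0) : EqOn h 0 (U ×ˢ V) := by
  have eventually_ofReal_mem : ∀ {W : Set ℂ} {t : ℝ}, IsOpen W → (t : ℂ) ∈ W →
      ∀ᶠ s : ℝ in 𝓝 t, (s : ℂ) ∈ W := fun hW ht =>
    Complex.continuous_ofReal.continuousAt.eventually (hW.mem_nhds ht)
  have zero_of_real_right : ∀ t : ℝ, (t : ℂ) ∈ V → EqOn (fun u => h (u, t)) 0 U := fun t ht =>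
    eqOn_zero_of_eventually_ofReal_eq_zero hU hUc hx
      (hd.comp (f := fun u => (u, (t : ℂ))) (by fun_prop) fun u hu => mk_mem_prod hu ht)
      ((eventually_ofReal_mem hU hx).mono fun s hs => h0 s t hs ht)
  rintro ⟨u, v⟩ ⟨hu, hv⟩
  exact eqOn_zero_of_eventually_ofReal_eq_zero (h := fun v => h (u, v)) hV hVc hy
    (hd.comp (f := fun v => (u, v)) (by fun_prop) fun v hv => mk_mem_prod hu hv)
    ((eventually_ofReal_mem hV hy).mono fun t ht => zero_of_real_right t ht hu) hv

theorem eventually_eq_zero_of_antidiagonal [CompleteSpace E] {f : ℂ → ℂ → E} {U : Set ℂ} {w₀ : ℂ}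
    (hU : U ∈ 𝓝 w₀) (hd : ∀ z ∈ U, ∀ w ∈ U, DifferentiableAt ℂ ↿f (z, conj w))
    (h0 : ∀ z ∈ U, f z (conj z) = 0) :
    ∀ᶠ z in 𝓝 w₀, f z (conj w₀) = 0 := by
  -- In these coordinates the antidiagonal consists of the real points.
  let φ : ℂ × ℂ → ℂ × ℂ := fun q =>
    (w₀ + (q.1 + Complex.I * q.2), conj w₀ + (q.1 - Complex.I * q.2))
  have mem_U : ∀ᶠ q in 𝓝 (0, 0), (φ q).1 ∈ U ∧ conj (φ q).2 ∈ U := by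
    have h₁ : Continuous fun q => (φ q).1 := by fun_prop
    have h₂ : Continuous fun q => conj (φ q).2 := Complex.continuous_conj.comp (by fun_prop)
    refine ((h₁.tendsto' (0, 0) w₀ ?_).eventually hU).and
      ((h₂.tendsto' (0, 0) w₀ ?_).eventually hU) <;> simp [φ]
  obtain ⟨r, hr, hrU⟩ := Metric.eventually_nhds_iff_ball.1 mem_U
  rw [← ball_prod_same] at hrU
  have f_comp_φ_eq_zero : EqOn (↿f ∘ φ) 0 (ball 0 r ×ˢ ball 0 r) := by
    have hball : ((0 : ℝ) : ℂ) ∈ ball (0 : ℂ) r := by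
      rw [Complex.ofReal_zero]; exact mem_ball_self hr
    refine eqOn_zero_prod_of_ofReal_eq_zero isOpen_ball (convex_ball _ _).isPreconnected hball
      isOpen_ball (convex_ball _ _).isPreconnected hball (fun q hq => ?_) fun s t hs ht => ?_
    · obtain ⟨h₁, h₂⟩ := hrU q hq
      have := hd _ h₁ _ h₂
      rw [Complex.conj_conj] at this
      exact (this.comp q (by fun_prop)).differentiableWithinAt
    · have := h0 _ (hrU (s, t) (mk_mem_prod hs ht)).1
      simpa [φ, sub_eq_add_neg, Function.HasUncurry.uncurry] using this
  have coord_tendsto : Tendsto (fun z => ((z - w₀) / 2, -Complex.I * ((z - w₀) / 2))) (𝓝 w₀)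
      (𝓝 ((0 : ℂ), (0 : ℂ))) :=
    (by fun_prop : Continuous _).tendsto' _ _ (by simp)
  filter_upwards [coord_tendsto.eventually
    (prod_mem_nhds (ball_mem_nhds (0 : ℂ) hr) (ball_mem_nhds (0 : ℂ) hr))] with z hz
  have φ_coord : φ ((z - w₀) / 2, -Complex.I * ((z - w₀) / 2)) = (z, conj w₀) := by
    ext <;> simp [φ, ← mul_assoc]
  have := f_comp_φ_eq_zero hz
  rwa [Function.comp_apply, φ_coord] at this

theorem eq_zero_of_antidiagonal [CompleteSpace E] {f : ℂ → ℂ → E} {U : Set ℂ} (hU : IsOpen U)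
    (hUc : IsPreconnected U) (hd : ∀ z ∈ U, ∀ w ∈ U, DifferentiableAt ℂ ↿f (z, conj w))
    (h0 : ∀ z ∈ U, f z (conj z) = 0) {z w : ℂ} (hz : z ∈ U) (hw : w ∈ U) : f z (conj w) = 0 := by
  have differentiableOn_left : DifferentiableOn ℂ (f · (conj w)) U := fun z hz =>
    ((hd z hz w hw).comp (f := fun z => (z, conj w)) z (by fun_prop)).differentiableWithinAt
  exact (differentiableOn_left.analyticOnNhd hU).eqOn_zero_of_preconnected_of_eventuallyEq_zero hUc
    hw (eventually_eq_zero_of_antidiagonal (hU.mem_nhds hw) hd h0) hz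

theorem differentiableAt_of_cauchyRiemann {F : Type*} [NormedAddCommGroup F] [NormedSpace ℝ F]
    (L : F →L[ℝ] E) {α β : ℝ × ℝ → F} {z : ℂ}
    (hα : DifferentiableAt ℝ α (z.re, z.im)) (hβ : DifferentiableAt ℝ β (z.re, z.im))
    (h₁ : deriv (fun s => α (s, z.im)) z.re = deriv (fun t => β (z.re, t)) z.im)
    (h₂ : deriv (fun s => β (s, z.im)) z.re = -deriv (fun t => α (z.re, t)) z.im) :
    DifferentiableAt ℂ (fun w : ℂ => L (α (w.re, w.im)) + Complex.I • L (β (w.re, w.im))) z := by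
  have deriv_fst : ∀ {γ : ℝ × ℝ → F}, DifferentiableAt ℝ γ (z.re, z.im) →
      deriv (fun s => γ (s, z.im)) z.re = fderiv ℝ γ (z.re, z.im) (1, 0) := fun hγ =>
    (hγ.hasFDerivAt.comp_hasDerivAt z.re
      ((hasDerivAt_id z.re).prodMk (hasDerivAt_const z.re z.im))).deriv
  have deriv_snd : ∀ {γ : ℝ × ℝ → F}, DifferentiableAt ℝ γ (z.re, z.im) →
      deriv (fun t => γ (z.re, t)) z.im = fderiv ℝ γ (z.re, z.im) (0, 1) := fun hγ =>
    (hγ.hasFDerivAt.comp_hasDerivAt z.im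
      ((hasDerivAt_const z.im z.re).prodMk (hasDerivAt_id z.im))).deriv
  rw [deriv_fst hα, deriv_snd hβ] at h₁
  rw [deriv_fst hβ, deriv_snd hα] at h₂
  have hasFDerivAt_comp : ∀ {γ : ℝ × ℝ → F}, DifferentiableAt ℝ γ (z.re, z.im) →
      HasFDerivAt (fun w : ℂ => L (γ (w.re, w.im)))
        (L ∘L fderiv ℝ γ (z.re, z.im) ∘L (Complex.equivRealProdCLM : ℂ →L[ℝ] ℝ × ℝ)) z := fun hγ =>
    L.hasFDerivAt.comp z (hγ.hasFDerivAt.comp z Complex.equivRealProdCLM.hasFDerivAt)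
  have total := (hasFDerivAt_comp hα).fun_add ((hasFDerivAt_comp hβ).fun_const_smul Complex.I)
  refine differentiableAt_complex_iff_differentiableAt_real.2 ⟨total.differentiableAt, ?_⟩
  rw [total.fderiv]
  simp [h₁, h₂, smul_smul, smul_add, add_comm]

end SeveralComplexVariables

section SliceEmbedding

open scoped ComplexConjugate

variable {i : ℍ}

theorem star_of_mem_imagUnits (hi : i ∈ imagUnits) : star i = -i :=
  Quaternion.star_eq_neg.2 hi.1

theorem mul_self_of_mem_imagUnits (hi : i ∈ imagUnits) : i * i = -1 := by
  have h : -(i * i) = 1 := by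
    rw [← neg_mul, ← star_of_mem_imagUnits hi, Quaternion.star_mul_self,
      Quaternion.normSq_eq_norm_mul_self, hi.2, mul_one, Quaternion.coe_one]
  rw [← h, neg_neg]

/-- The embedding `a + b I ↦ a + i b` of `ℂ` into the quaternions, with range `ℂ_i`. -/
noncomputable def sliceEmb (hi : i ∈ imagUnits) : ℂ →ₐ[ℝ] ℍ :=
  Complex.liftAux i (mul_self_of_mem_imagUnits hi)

theorem sliceEmb_apply (hi : i ∈ imagUnits) (z : ℂ) :
    sliceEmb hi z = (z.re : ℍ) + i * (z.im : ℍ) := by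
  rw [← Quaternion.coe_commutes, Quaternion.coe_mul_eq_smul]
  rfl

theorem range_sliceEmb (hi : i ∈ imagUnits) : Set.range (sliceEmb hi) = slicePlane i := by
  ext x
  constructor
  · rintro ⟨z, rfl⟩
    exact ⟨z.re, z.im, sliceEmb_apply hi z⟩
  · rintro ⟨a, b, rfl⟩
    exact ⟨⟨a, b⟩, sliceEmb_apply hi _⟩

theorem star_sliceEmb (hi : i ∈ imagUnits) (z : ℂ) :
    star (sliceEmb hi z) = sliceEmb hi (conj z) := by
  simp only [sliceEmb_apply, star_add, star_mul, Quaternion.star_coe, star_of_mem_imagUnits hi,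
    Complex.conj_re, Complex.conj_im, Quaternion.coe_neg, Quaternion.coe_commutes, mul_neg]

theorem norm_sliceEmb (hi : i ∈ imagUnits) (z : ℂ) : ‖sliceEmb hi z‖ = ‖z‖ := by
  have h : ((‖sliceEmb hi z‖ * ‖sliceEmb hi z‖ : ℝ) : ℍ) = ((‖z‖ * ‖z‖ : ℝ) : ℍ) := by
    rw [← Quaternion.normSq_eq_norm_mul_self, ← Quaternion.self_mul_star, star_sliceEmb, ← map_mul,
      Complex.mul_conj, Complex.normSq_eq_norm_sq, sq]
    exact (sliceEmb hi).commutes _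
  exact (mul_self_inj (norm_nonneg _) (norm_nonneg _)).1 (Quaternion.coe_injective h)

theorem sliceEmb_preimage_unitBall (hi : i ∈ imagUnits) :
    sliceEmb hi ⁻¹' unitBall = Metric.ball 0 1 := by
  ext z
  rw [Set.mem_preimage, unitBall, mem_ball_zero_iff, mem_ball_zero_iff, norm_sliceEmb]

/-- The orthogonal projection of the quaternions onto `ℂ_i`, with `ℂ_i` identified with `ℂ`. -/
noncomputable def sliceProj (i : ℍ) : ℍ →L[ℝ] ℂ :=
  (Complex.equivRealProdCLM.symm : ℝ × ℝ →L[ℝ] ℂ) ∘L (innerSL ℝ (1 : ℍ)).prod (innerSL ℝ i)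

theorem sliceProj_re (i q : ℍ) : (sliceProj i q).re = q.re := by
  simp [sliceProj, Quaternion.inner_def]

theorem sliceProj_im (hi : i ∈ imagUnits) (q : ℍ) : (sliceProj i q).im = -(i * q).re := by
  have inner_eq : (sliceProj i q).im = (i * star q).re := rfl
  simp only [inner_eq, Quaternion.re_mul, Quaternion.re_star, Quaternion.imI_star,
    Quaternion.imJ_star, Quaternion.imK_star, hi.1]
  ring

theorem sliceProj_star (hi : i ∈ imagUnits) (q : ℍ) :
    sliceProj i (star q) = conj (sliceProj i q) := by
  apply Complex.ext
  · rw [sliceProj_re, Complex.conj_re, sliceProj_re, Quaternion.re_star]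
  · rw [sliceProj_im hi, Complex.conj_im, sliceProj_im hi]
    simp only [Quaternion.re_mul, Quaternion.re_star, Quaternion.imI_star, Quaternion.imJ_star,
      Quaternion.imK_star, hi.1]
    ring

theorem sliceProj_sliceEmb_mul (hi : i ∈ imagUnits) (z : ℂ) (q : ℍ) :
    sliceProj i (sliceEmb hi z * q) = z * sliceProj i q := by
  have proj_mul_left : sliceProj i (i * q) = Complex.I * sliceProj i q := by
    apply Complex.ext <;>
      simp [sliceProj_re, sliceProj_im hi, ← mul_assoc, mul_self_of_mem_imagUnits hi]
  rw [sliceEmb_apply, ← Quaternion.coe_commutes, add_mul, mul_assoc, Quaternion.coe_mul_eq_smul,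
    Quaternion.coe_mul_eq_smul, map_add, map_smul, map_smul, proj_mul_left, Complex.real_smul,
    Complex.real_smul, ← mul_assoc, ← add_mul, Complex.re_add_im]

theorem exists_mem_imagUnits_eq_add_mul (hi : i ∈ imagUnits) (q : ℍ) :
    ∃ j ∈ imagUnits, ∃ b : ℝ, q = (q.re : ℍ) + j * (b : ℍ) := by
  obtain him | him := eq_or_ne q.im 0
  · refine ⟨i, hi, 0, ?_⟩
    rw [Quaternion.coe_zero, mul_zero, ← him, Quaternion.re_add_im]
  · refine ⟨‖q.im‖⁻¹ • q.im, ⟨by simp, ?_⟩, ‖q.im‖, ?_⟩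
    · rw [norm_smul, norm_inv, norm_norm, inv_mul_cancel₀ (norm_ne_zero_iff.2 him)]
    · rw [Quaternion.mul_coe_eq_smul, smul_inv_smul₀ (norm_ne_zero_iff.2 him),
        Quaternion.re_add_im]

namespace IsLeftSliceHyperholomorphic

theorem differentiableOn_sliceProj {U : Set ℍ} {f : U → ℍ}
    (hf : IsLeftSliceHyperholomorphic f) (hi : i ∈ imagUnits) {F : ℍ → ℍ}
    (hF : ∀ x : U, F x = f x) :
    DifferentiableOn ℂ (fun z => sliceProj i (F (sliceEmb hi z))) (sliceEmb hi ⁻¹' U) := by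
  obtain ⟨-, α, β, hαβ, hCR⟩ := hf
  have mem_iff : ∀ z, z ∈ sliceEmb hi ⁻¹' U ↔ (z.re : ℍ) + i * (z.im : ℍ) ∈ U := fun z => by
    rw [← sliceEmb_apply hi, Set.mem_preimage]
  have components : ∀ z ∈ sliceEmb hi ⁻¹' U, sliceProj i (F (sliceEmb hi z)) =
      sliceProj i (α (z.re, z.im)) + Complex.I • sliceProj i (β (z.re, z.im)) := fun z hz => by
    rw [sliceEmb_apply, hF ⟨_, (mem_iff z).1 hz⟩, hαβ i hi, map_add, smul_eq_mul,
      ← sliceProj_sliceEmb_mul hi, sliceEmb, Complex.liftAux_apply_I]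
  intro z hz
  obtain ⟨-, -, hα, hβ, h₁, h₂⟩ := hCR i hi z.re z.im ((mem_iff z).1 hz)
  exact (differentiableAt_of_cauchyRiemann (sliceProj i) hα hβ h₁ h₂).differentiableWithinAt.congr
    components (components z hz)

theorem eq_zero_of_forall_sliceDisc {f : unitBall → ℍ} (hf : IsLeftSliceHyperholomorphic f)
    (hi : i ∈ imagUnits) (h0 : ∀ q ∈ sliceDisc i, f q = 0) : f = 0 := by
  obtain ⟨-, α, β, hαβ, hCR⟩ := hf
  ext1 q
  obtain ⟨j, hj, b, hq⟩ := exists_mem_imagUnits_eq_add_mul hi (q : ℍ)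
  set a := (q : ℍ).re
  have norm_eq : ∀ {k : ℍ}, k ∈ imagUnits → ∀ c : ℝ,
      ‖(a : ℍ) + k * (c : ℍ)‖ = √(a ^ 2 + c ^ 2) := fun hk c => by
    rw [← sliceEmb_apply hk ⟨a, c⟩, norm_sliceEmb, Complex.norm_eq_sqrt_sq_add_sq]
  have mem_j : (a : ℍ) + j * (b : ℍ) ∈ unitBall := hq ▸ q.2
  have mem_i : (a : ℍ) + i * (b : ℍ) ∈ unitBall := by
    rwa [unitBall, mem_ball_zero_iff, norm_eq hi, ← norm_eq hj, ← mem_ball_zero_iff]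
  have mem_neg : (a : ℍ) + i * ((-b : ℝ) : ℍ) ∈ unitBall := by
    rwa [unitBall, mem_ball_zero_iff, norm_eq hi, neg_sq, ← norm_eq hi,
      ← mem_ball_zero_iff]
  obtain ⟨α_even, β_odd, -⟩ := hCR i hi a b mem_i
  have α_add_eq_zero : α (a, b) + i * β (a, b) = 0 := by
    rw [← hαβ i hi a b mem_i, h0 _ ⟨a, b, rfl⟩]
  have α_sub_eq_zero : α (a, b) - i * β (a, b) = 0 := by
    rw [sub_eq_add_neg, ← mul_neg, ← α_even, ← β_odd, ← hαβ i hi a (-b) mem_neg,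
      h0 _ ⟨a, -b, rfl⟩]
  have α_eq_zero : α (a, b) = 0 := by
    linear_combination (norm := module) (1 / 2 : ℝ) • α_add_eq_zero + (1 / 2 : ℝ) • α_sub_eq_zero
  have β_eq_zero : β (a, b) = 0 := by
    rw [α_eq_zero, zero_add, mul_eq_zero] at α_add_eq_zero
    exact α_add_eq_zero.resolve_left (norm_ne_zero_iff.1 (hi.2.trans_ne one_ne_zero))
  calc f q = f ⟨_, mem_j⟩ := congrArg f (Subtype.ext hq)
    _ = 0 := by rw [hαβ j hj, α_eq_zero, β_eq_zero, mul_zero, add_zero]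

end IsLeftSliceHyperholomorphic

end SliceEmbedding

section BerezinSymbol

open Filter Metric Set
open scoped Topology ComplexConjugate

variable {E : Type*} [NormedAddCommGroup E] [InnerProductSpace ℂ E] [CompleteSpace E]

theorem exists_norm_le_of_continuousOn_inner {X : Type*} [TopologicalSpace X] {k : X → E}
    {s : Set X} (hs : IsCompact s) (hk : ∀ x, ContinuousOn (fun z => inner ℂ (k z) x) s) :
    ∃ C, ∀ z ∈ s, ‖k z‖ ≤ C := by
  obtain ⟨C, hC⟩ := banach_steinhaus (g := fun z : s => innerSL ℂ (k z)) fun x => by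
    obtain ⟨C, hC⟩ := hs.exists_bound_of_continuousOn (hk x)
    exact ⟨C, fun z => hC z z.2⟩
  exact ⟨C, fun z hz => (innerSL_apply_norm (𝕜 := ℂ) (k z)).symm.trans_le (hC ⟨z, hz⟩)⟩

variable {k : ℂ → E} {U : Set ℂ}

theorem exists_eventually_norm_le_of_differentiableOn_inner (hU : IsOpen U)
    (hk : ∀ x, DifferentiableOn ℂ (fun z => inner ℂ (k z) x) U) {z : ℂ} (hz : z ∈ U) :
    ∃ C, ∀ᶠ w in 𝓝 z, ‖k w‖ ≤ C := by
  obtain ⟨K, hK, hzK, hKU⟩ := exists_compact_subset hU hz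
  obtain ⟨C, hC⟩ := exists_norm_le_of_continuousOn_inner hK fun x => (hk x).continuousOn.mono hKU
  exact ⟨C, mem_of_superset (mem_interior_iff_mem_nhds.1 hzK) hC⟩

theorem differentiableAt_inner_apply_conj (A : E →L[ℂ] E) (hU : IsOpen U)
    (hk : ∀ x, DifferentiableOn ℂ (fun z => inner ℂ (k z) x) U) {z w : ℂ} (hz : z ∈ U)
    (hw : w ∈ U) :
    DifferentiableAt ℂ ↿(fun z w => inner ℂ (k z) (A (k (conj w)))) (z, conj w) := by
  have left : ∀ x, ∀ z ∈ U, DifferentiableAt ℂ (fun z => inner ℂ (k z) x) z := fun x z hz =>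
    (hk x).differentiableAt (hU.mem_nhds hz)
  have right : ∀ x w, conj w ∈ U → DifferentiableAt ℂ (fun w => inner ℂ x (A (k (conj w)))) w := by
    intro x w hw
    have := (left (A.adjoint x) (conj w) hw).conj_conj
    simpa only [Complex.conj_conj, Function.comp_def, inner_conj_symm,
      ContinuousLinearMap.adjoint_inner_left] using this
  have conj_tendsto : Tendsto (fun v : ℂ × ℂ => conj v.2) (𝓝 (z, conj w)) (𝓝 w) :=
    (Complex.continuous_conj.comp continuous_snd).tendsto' _ _ (Complex.conj_conj w)
  have fst_tendsto : Tendsto Prod.fst (𝓝 (z, conj w)) (𝓝 z) := continuous_fst.tendsto _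
  obtain ⟨C₁, hC₁⟩ := exists_eventually_norm_le_of_differentiableOn_inner hU hk hz
  obtain ⟨C₂, hC₂⟩ := exists_eventually_norm_le_of_differentiableOn_inner hU hk hw
  refine differentiableAt_uncurry_of_separately_differentiable (M := C₁ * (‖A‖ * C₂)) ?_ ?_ ?_
  · exact (fst_tendsto.eventually (hU.mem_nhds hz)).mono fun v hv => left _ _ hv
  · exact (conj_tendsto.eventually (hU.mem_nhds hw)).mono fun v hv => right _ _ hv
  · filter_upwards [fst_tendsto.eventually hC₁, conj_tendsto.eventually hC₂] with v h₁ h₂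
    calc ‖inner ℂ (k v.1) (A (k (conj v.2)))‖
        ≤ ‖k v.1‖ * ‖A (k (conj v.2))‖ := norm_inner_le_norm _ _
      _ ≤ C₁ * (‖A‖ * C₂) := by
        gcongr
        · exact (norm_nonneg _).trans h₁
        · exact A.le_opNorm_of_le h₂

theorem inner_apply_eq_zero_of_inner_apply_self_eq_zero (A : E →L[ℂ] E) (hU : IsOpen U)
    (hUc : IsPreconnected U) (hk : ∀ x, DifferentiableOn ℂ (fun z => inner ℂ (k z) x) U)
    (h0 : ∀ z ∈ U, inner ℂ (k z) (A (k z)) = 0) {z w : ℂ} (hz : z ∈ U) (hw : w ∈ U) :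
    inner ℂ (k z) (A (k w)) = 0 := by
  have := eq_zero_of_antidiagonal (f := fun z w => inner ℂ (k z) (A (k (conj w)))) hU hUc
    (fun z hz w hw => differentiableAt_inner_apply_conj A hU hk hz hw)
    (fun z hz => by rw [Complex.conj_conj, h0 z hz]) hz hw
  rwa [Complex.conj_conj] at this

theorem apply_eq_zero_of_inner_apply_self_eq_zero (A : E →L[ℂ] E) (hU : IsOpen U)
    (hUc : IsPreconnected U) (hk : ∀ x, DifferentiableOn ℂ (fun z => inner ℂ (k z) x) U)
    (hA : ∀ z ∈ U, A (k z) ∈ closure (Submodule.span ℂ (k '' U) : Set E))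
    (h0 : ∀ z ∈ U, inner ℂ (k z) (A (k z)) = 0) {z : ℂ} (hz : z ∈ U) : A (k z) = 0 := by
  have span_le : Submodule.span ℂ (k '' U) ≤ (ℂ ∙ A (k z))ᗮ := by
    rw [Submodule.span_le]
    rintro _ ⟨w, hw, rfl⟩
    exact Submodule.mem_orthogonal_singleton_iff_inner_left.2
      (inner_apply_eq_zero_of_inner_apply_self_eq_zero A hU hUc hk h0 hw hz)
  have mem_orthogonal : A (k z) ∈ (ℂ ∙ A (k z))ᗮ :=
    closure_minimal span_le (Submodule.isClosed_orthogonal _) (hA z hz)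
  exact inner_self_eq_zero.1 (Submodule.mem_orthogonal_singleton_iff_inner_left.1 mem_orthogonal)

end BerezinSymbol

section QuaternionicHilbertSpace

open QuaternionicHilbertSpace SliceRKHS

variable {H : Type*} [NormedAddCommGroup H] [Module ℍᵐᵒᵖ H] {i : ℍ}

theorem mapsTo_plusSpace {J T : H →L[ℍᵐᵒᵖ] H} (hT : T ∈ commutingOperators J) :
    Set.MapsTo T (plusSpace J i) (plusSpace J i) := fun x hx => by
  calc J (T x) = T (J x) := (DFunLike.congr_fun hT x).symm
    _ = op i • T x := by rw [hx, map_smul]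

theorem subset_sliceSpan (i : ℍ) (s : Set H) : s ⊆ sliceSpan i s := fun x hx =>
  AddSubgroup.subset_closure ⟨x, hx, 1, ⟨1, 0, by simp⟩, by simp⟩

theorem sub_mem_closure_sliceSpan {s : Set H} {x y : H} (hx : x ∈ closure (sliceSpan i s))
    (hy : y ∈ closure (sliceSpan i s)) : x - y ∈ closure (sliceSpan i s) :=
  (AddSubgroup.closure _).topologicalClosure.sub_mem hx hy

variable [QuaternionicHilbertSpace H]

theorem ip_sub (x y z : H) : ip x (y - z) = ip x y - ip x z :=
  eq_sub_of_add_eq (by rw [← ip_add, sub_add_cancel])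

/-- A quaternionic Hilbert space as a complex Hilbert space: scalars act from the right through
`ℂ_i`, and the scalar product is the `ℂ_i`-part of the quaternionic one. -/
noncomputable abbrev complexInnerProductSpace (hi : i ∈ imagUnits) : InnerProductSpace ℂ H where
  toModule := Module.compHom H
    ((sliceEmb hi).toRingHom.toOpposite fun z w => (Commute.all z w).map (sliceEmb hi))
  norm_smul_le z x := by
    change ‖op (sliceEmb hi z) • x‖ ≤ _
    rw [norm_op_smul, norm_sliceEmb, mul_comm]
  inner x y := sliceProj i (ip x y)
  norm_sq_eq_re_inner x := (norm_sq_eq x).trans (sliceProj_re i _).symm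
  conj_inner_symm x y := by rw [← sliceProj_star hi, ← ip_star]
  add_left x y z := by rw [ip_add_left, map_add]
  smul_left x y z := by
    change sliceProj i (ip (op (sliceEmb hi z) • x) y) = _
    rw [ip_smul_left, star_sliceEmb, sliceProj_sliceEmb_mul]

theorem sliceSpan_subset_span (hi : i ∈ imagUnits) (s : Set H) :
    letI := complexInnerProductSpace (H := H) hi
    sliceSpan i s ⊆ Submodule.span ℂ s := by
  let _ := complexInnerProductSpace (H := H) hi
  refine (AddSubgroup.closure_le (Submodule.span ℂ s).toAddSubgroup).2 ?_
  rintro _ ⟨x, hx, a, ha, rfl⟩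
  obtain ⟨z, rfl⟩ := (range_sliceEmb hi).superset ha
  exact Submodule.smul_mem _ z (Submodule.subset_span hx)

variable [SliceRKHS H]

theorem eval_eq_ip (f : H) (w : unitBall) : eval f w = ip (kernelFun H w) f :=
  (exists_kernel (H := H) w).choose_spec f

theorem kernelFun_ne_zero {q : unitBall} (hq : ∃ f : H, eval f q ≠ 0) : kernelFun H q ≠ 0 := by
  intro h
  obtain ⟨f, hf⟩ := hq
  exact hf (by rw [eval_eq_ip, h, ip_star, ip_zero, star_zero])

theorem op_norm_smul_normalizedKernel {q : unitBall} (hq : kernelFun H q ≠ 0) :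
    op ((‖kernelFun H q‖ : ℝ) : ℍ) • normalizedKernel H q = kernelFun H q := by
  rw [normalizedKernel, kernel, eval_eq_ip, ← norm_eq, smul_smul, ← op_mul, ← Quaternion.coe_mul,
    inv_mul_cancel₀ (norm_ne_zero_iff.2 hq), Quaternion.coe_one, op_one, one_smul]

theorem ip_kernelFun_apply_eq_zero_of_berezin_eq {T S : H →L[ℍᵐᵒᵖ] H} {q : sliceDisc i}
    (hq : kernelFun H q ≠ 0) (hTS : berezin i T q = berezin i S q) :
    ip (kernelFun H q) ((T - S) (kernelFun H q)) = 0 := by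
  have ip_normalizedKernel : ip (normalizedKernel H q) ((T - S) (normalizedKernel H q)) = 0 := by
    rw [sub_apply, ip_sub]
    exact sub_eq_zero.2 hTS
  rw [← op_norm_smul_normalizedKernel hq, map_smul, ip_smul, ip_smul_left, ip_normalizedKernel,
    mul_zero, zero_mul]

theorem dense_span_kernelFun (hi : i ∈ imagUnits) :
    Dense (Submodule.span ℍᵐᵒᵖ (kernelFun H '' sliceDisc i) : Set H) := by
  let _ := complexInnerProductSpace (H := H) hi
  have : CompleteSpace H := complete
  let N : Submodule ℂ H :=
    { (Submodule.span ℍᵐᵒᵖ (kernelFun H '' sliceDisc i)).toAddSubmonoid with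
      smul_mem' := fun z _ hx => Submodule.smul_mem _ (op (sliceEmb hi z)) hx }
  refine (Submodule.dense_iff_topologicalClosure_eq_top (s := N)).2 ?_
  rw [Submodule.topologicalClosure_eq_top_iff, Submodule.eq_bot_iff]
  intro x hx
  have eval_eq_zero : ∀ q ∈ sliceDisc i, eval x q = 0 := fun q hq => by
    have mem_N : op (eval x q) • kernelFun H q ∈ N :=
      Submodule.smul_mem _ _ (Submodule.subset_span (Set.mem_image_of_mem _ hq))
    have inner_eq_zero : sliceProj i (ip (op (eval x q) • kernelFun H q) x) = 0 :=
      (Submodule.mem_orthogonal N x).1 hx _ mem_N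
    rw [ip_smul_left, ← eval_eq_ip, Quaternion.star_mul_self] at inner_eq_zero
    have := congrArg Complex.re inner_eq_zero
    rwa [sliceProj_re, Quaternion.re_coe, Complex.zero_re, Quaternion.normSq_eq_zero] at this
  exact eval_injective (((slice x).eq_zero_of_forall_sliceDisc hi eval_eq_zero).trans
    (map_zero eval).symm)

/-- The kernel functions along `ℂ_i` in terms of a complex parameter, extended by zero outside the
unit disc. -/
noncomputable def sliceKernel (H : Type*) [NormedAddCommGroup H] [Module ℍᵐᵒᵖ H]
    [QuaternionicHilbertSpace H] [SliceRKHS H] (hi : i ∈ imagUnits) (z : ℂ) : H :=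
  Function.extend Subtype.val (kernelFun H) 0 (sliceEmb hi z)

theorem sliceKernel_of_coe_eq (hi : i ∈ imagUnits) {q : unitBall} {z : ℂ}
    (hz : sliceEmb hi z = q) : sliceKernel H hi z = kernelFun H q := by
  rw [sliceKernel, hz, Subtype.val_injective.extend_apply]

theorem sliceKernel_image_ball (hi : i ∈ imagUnits) :
    sliceKernel H hi '' Metric.ball 0 1 = kernelFun H '' sliceDisc i := by
  rw [← sliceEmb_preimage_unitBall hi]
  apply Set.Subset.antisymm
  · rintro _ ⟨z, hz, rfl⟩
    exact ⟨⟨_, hz⟩, (range_sliceEmb hi).subset ⟨z, rfl⟩, (sliceKernel_of_coe_eq hi rfl).symm⟩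
  · rintro _ ⟨q, hq, rfl⟩
    obtain ⟨z, hz⟩ := (range_sliceEmb hi).superset hq
    exact ⟨z, Set.mem_preimage.2 (hz ▸ q.2), sliceKernel_of_coe_eq hi hz⟩

theorem differentiableOn_sliceProj_ip_sliceKernel (hi : i ∈ imagUnits) (x : H) :
    DifferentiableOn ℂ (fun z => sliceProj i (ip (sliceKernel H hi z) x)) (Metric.ball 0 1) := by
  rw [← sliceEmb_preimage_unitBall hi]
  refine (slice x).differentiableOn_sliceProj hi
    (F := fun q => ip (Function.extend Subtype.val (kernelFun H) 0 q) x) fun q => ?_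
  rw [Subtype.val_injective.extend_apply, eval_eq_ip]

theorem eqOn_zero_kernelFun_of_ip_eq_zero (hi : i ∈ imagUnits) {A : H →L[ℍᵐᵒᵖ] H}
    (hA : Set.MapsTo A (kernelFun H '' sliceDisc i)
      (closure (sliceSpan i (kernelFun H '' sliceDisc i))))
    (h0 : ∀ q ∈ sliceDisc i, ip (kernelFun H q) (A (kernelFun H q)) = 0) :
    Set.EqOn A 0 (kernelFun H '' sliceDisc i) := by
  let _ := complexInnerProductSpace (H := H) hi
  have : CompleteSpace H := complete
  have : LinearMap.CompatibleSMul H H ℂ ℍᵐᵒᵖ := ⟨fun f z x => f.map_smul (op (sliceEmb hi z)) x⟩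
  have mapsTo_span : ∀ x ∈ kernelFun H '' sliceDisc i,
      A x ∈ closure (Submodule.span ℂ (kernelFun H '' sliceDisc i) : Set H) := fun x hx =>
    closure_mono (sliceSpan_subset_span hi _) (hA hx)
  have inner_eq_zero : ∀ x ∈ kernelFun H '' sliceDisc i, inner ℂ x (A x) = 0 := by
    rintro _ ⟨q, hq, rfl⟩
    exact (congrArg (sliceProj i) (h0 q hq)).trans (map_zero _)
  rw [← sliceKernel_image_ball hi] at mapsTo_span inner_eq_zero ⊢
  rintro _ ⟨z, hz, rfl⟩
  exact apply_eq_zero_of_inner_apply_self_eq_zero (A.restrictScalars ℂ) Metric.isOpen_ball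
    (convex_ball _ _).isPreconnected (differentiableOn_sliceProj_ip_sliceKernel hi)
    (fun z hz => mapsTo_span _ (Set.mem_image_of_mem _ hz))
    (fun z hz => inner_eq_zero _ (Set.mem_image_of_mem _ hz)) hz

end QuaternionicHilbertSpace

end QuaternionicBerezin

theorem mainTheorem11_general {H : Type*} [NormedAddCommGroup H] [Module ℍᵐᵒᵖ H]
    [QuaternionicHilbertSpace H] [SliceRKHS H] {i : ℍ} (hi : i ∈ imagUnits)
    (hne : ∀ q ∈ sliceDisc i, ∃ f : H, SliceRKHS.eval f q ≠ 0) :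
    Set.InjOn (fun T : H →L[ℍᵐᵒᵖ] H => berezin i T)
      {T | Set.MapsTo T (closure (sliceSpan i (kernelFun H '' sliceDisc i)))
        (closure (sliceSpan i (kernelFun H '' sliceDisc i)))} := by
  intro T hT S hS hTS
  have mapsTo_sub : Set.MapsTo (T - S) (kernelFun H '' sliceDisc i)
      (closure (sliceSpan i (kernelFun H '' sliceDisc i))) := fun x hx =>
    have hx := subset_closure (subset_sliceSpan i _ hx)
    sub_mem_closure_sliceSpan (hT hx) (hS hx)
  have sub_eqOn_zero : Set.EqOn (T - S) 0 (kernelFun H '' sliceDisc i) :=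
    eqOn_zero_kernelFun_of_ip_eq_zero hi mapsTo_sub fun q hq =>
      ip_kernelFun_apply_eq_zero_of_berezin_eq (q := ⟨q, hq⟩) (kernelFun_ne_zero (hne q hq))
        (congrFun hTS ⟨q, hq⟩)
  exact ContinuousLinearMap.ext_on (dense_span_kernelFun hi) fun x hx =>
    sub_eq_zero.1 (sub_eqOn_zero hx)

theorem mainTheorem11 {H : Type*} [NormedAddCommGroup H] [Module ℍᵐᵒᵖ H]
    [QuaternionicHilbertSpace H] [SliceRKHS H]
    (hne : ∀ q : unitBall, ∃ f : H, SliceRKHS.eval f q ≠ 0)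
    (i : ℍ) (hi : i ∈ imagUnits)
    (J : H →L[ℍᵐᵒᵖ] H) (hJa : IsAntiSelfAdjoint J) (hJu : IsUnitary J)
    (hJ : plusSpace J i = closure (sliceSpan i (kernelFun H '' sliceDisc i))) :
    Set.InjOn (fun T : H →L[ℍᵐᵒᵖ] H => berezin i T) (commutingOperators J) :=
  (mainTheorem11_general hi fun q _ => hne q).mono fun _ hT => hJ ▸ mapsTo_plusSpace hT
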